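/- Let $K$ be a field, $a,b\ge 0$ integers, $\ell=a+b$. Let $x_0,\dots,x_k\in K$ be distinct, let $a_0,\dots,a_k\ge 0$ be integers with $a_0+\cdots+a_k=\ell+1$, and let $y_{i,j}\in K$ for $0\le i\le k$, $0\le j<a_i$. The osculatory rational interpolation problem asks for polynomials $A,B\in K[x]$, $B\neq 0$, with $\deg A\le a$, $\deg B\le b$, such that for every $i$ with $a_i\ge 1$ the rational function $A/B$ has no pole at $x_i$, and $$\frac{1}{j!}\Big(\frac AB\Big)^{(j)}(x_i)=y_{i,j}\qquad(0\le i\le k,\ 0\le j<a_i),\tag{1}$$ where the left-hand side denotes the $j$-th Taylor coefficient of $A/B$ at $x_i$ (the coefficient of $t^j$ in the power series of $(A/B)(x_i+t)$). If $j!\ne 0$ in $K$ for all $j<\max_i a_i$, then (1) may equivalently be read as $(A/B)^{(j)}(x_i)=j!\,y_{i,j}$ with iterated formal derivatives. For $n\ge 1$ let $V_n$ and $U_n$ be the $n\times(\ell+1)$ matrices over $K$ whose columns are indexed by the pairs $(i,t)$, $0\le i\le k$, $0\le t<a_i$, in lexicographic order, and whose entries in row $r$ ($0\le r\le n-1$)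 and column $(i,t)$ are $$\binom rt x_i^{r-t}\qquad\text{and}\qquad \sum_{j=0}^{t}\binom rj\,y_{i,t-j}\,x_i^{r-j},$$ respectively, where $\binom rj x_i^{r-j}=0$ if $r<j$. For $0\le d\le \ell$ put $$A_{0,d}=-\det\begin{pmatrix}V_{d+1}&(1,x,\dots,x^{d})^{T}\\ U_{\ell-d+1}&\mathbf 0\end{pmatrix},\qquad B_{0,d}=\det\begin{pmatrix}V_{d+1}&\mathbf 0\\ U_{\ell-d+1}&(1,x,\dots,x^{\ell-d})^{T}\end{pmatrix}\ \in K[x].$$ Suppose that $A_{0,d}\neq 0$ for some $d$ with $0\le d\le a$, let $d$ be the maximal such index, and set $A_0=A_{0,d}$, $B_0=B_{0,d}$. Then $\deg B_0\le b$, and the osculatory rational interpolation problem has a solution if and only if $B_0(x_i)\ne 0$ for all $i$ with $a_i\ge 1$. In that case $(A_0,B_0)$ is a solution, and every solution $(A,B)$ satisfies $A/B=A_0/B_0$ in $K(x)$. If $j!\neq0$ in $K$ for all $j<\max_i a_i$, the same holds with (1) replaced by $(A/B)^{(j)}(x_i)=j!\,y_{i,j}$. -/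

import Mathlib

open Polynomial

namespace Osculatory

noncomputable section

variable {K : Type*} [Field K]

/-- The confluent (generalized) Vandermonde matrix with `n` rows. The columns are indexed by the
pairs `(i, t)` with `0 ≤ t < m i`; the entry in row `r` is `(r choose t) * x_i ^ (r - t)`
(which is `0` for `r < t`). -/
def confluentV {k : ℕ} (x : Fin (k + 1) → K) (m : Fin (k + 1) → ℕ) (n : ℕ) :
    Matrix (Fin n) (Σ i : Fin (k + 1), Fin (m i)) K :=
  fun r c => ((r : ℕ).choose (c.2 : ℕ) : K) * x c.1 ^ ((r : ℕ) - (c.2 : ℕ))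

/-- The data matrix with `n` rows; the entry in row `r` and column `(i, t)` is
`∑_{j = 0}^{t} (r choose j) * y_{i, t - j} * x_i ^ (r - j)`. -/
def dataU {k : ℕ} (x : Fin (k + 1) → K) (m : Fin (k + 1) → ℕ)
    (y : (i : Fin (k + 1)) → Fin (m i) → K) (n : ℕ) :
    Matrix (Fin n) (Σ i : Fin (k + 1), Fin (m i)) K :=
  fun r c => ∑ j : Fin ((c.2 : ℕ) + 1),
    ((r : ℕ).choose (j : ℕ) : K) * y c.1 ⟨(c.2 : ℕ) - (j : ℕ), by omega⟩ *
      x c.1 ^ ((r : ℕ) - (j : ℕ))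

/-- The rows of the two blocks, numbered from top to bottom. -/
def rowEquiv (d l : ℕ) (hd : d ≤ l) : Fin (d + 1) ⊕ Fin (l - d + 1) ≃ Fin (l + 2) :=
  finSumFinEquiv.trans (finCongr (by omega))

/-- The columns, numbered from left to right: first the columns `(0, 0), …, (0, m 0 - 1)`, then
`(1, 0), …, (1, m 1 - 1)`, and so on, and the additional column at the end. -/
def colEquiv {k : ℕ} (m : Fin (k + 1) → ℕ) (l : ℕ) (hm : ∑ i, m i = l + 1) :
    (Σ i : Fin (k + 1), Fin (m i)) ⊕ Fin 1 ≃ Fin (l + 2) :=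
  (Equiv.sumCongr finSigmaFinEquiv (Equiv.refl (Fin 1))).trans
    (finSumFinEquiv.trans (finCongr (by omega)))

/-- The square matrix of size `l + 2` with the confluent Vandermonde matrix with `d + 1` rows above
the data matrix with `l - d + 1` rows, and with the additional last column
`(top, bottom)`. -/
def bordered {k : ℕ} (x : Fin (k + 1) → K) (m : Fin (k + 1) → ℕ)
    (y : (i : Fin (k + 1)) → Fin (m i) → K) (l : ℕ) (hm : ∑ i, m i = l + 1)
    (d : ℕ) (hd : d ≤ l) (top : Fin (d + 1) → K[X]) (bottom : Fin (l - d + 1) → K[X]) :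
    Matrix (Fin (l + 2)) (Fin (l + 2)) K[X] :=
  Matrix.reindex (rowEquiv d l hd) (colEquiv m l hm)
    (Matrix.fromBlocks
      ((confluentV x m (d + 1)).map C) (fun r _ => top r)
      ((dataU x m y (l - d + 1)).map C) (fun r _ => bottom r))

/-- The polynomial `A₀` for the index `d`. -/
def A₀ {k : ℕ} (x : Fin (k + 1) → K) (m : Fin (k + 1) → ℕ)
    (y : (i : Fin (k + 1)) → Fin (m i) → K) (l : ℕ) (hm : ∑ i, m i = l + 1)
    (d : ℕ) (hd : d ≤ l) : K[X] :=
  -(bordered x m y l hm d hd (fun r => X ^ (r : ℕ)) 0).det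

/-- The polynomial `B₀` for the index `d`. -/
def B₀ {k : ℕ} (x : Fin (k + 1) → K) (m : Fin (k + 1) → ℕ)
    (y : (i : Fin (k + 1)) → Fin (m i) → K) (l : ℕ) (hm : ∑ i, m i = l + 1)
    (d : ℕ) (hd : d ≤ l) : K[X] :=
  (bordered x m y l hm d hd 0 (fun r => X ^ (r : ℕ))).det

/-- The rational function `A / B`. -/
def quot (A B : K[X]) : RatFunc K := algebraMap K[X] (RatFunc K) A / algebraMap K[X] (RatFunc K) B

/-- The rational function `q` has no pole at `c`. -/
def RegularAt (q : RatFunc K) (c : K) : Prop := q.denom.eval c ≠ 0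

/-- The `j`-th Taylor coefficient at `c` of a rational function that is regular at `c`: the
coefficient of `X ^ j` in the power series of `q (c + X)`. It is the `j`-th derivative at `c`
divided by `j !`, and it makes sense in every characteristic. -/
def taylorCoeff (q : RatFunc K) (c : K) (j : ℕ) : K :=
  PowerSeries.coeff j
    ((taylor c q.num : PowerSeries K) * (taylor c q.denom : PowerSeries K)⁻¹)

/-- The formal derivative of a rational function, by the quotient rule. -/
def ratDeriv (q : RatFunc K) : RatFunc K :=
  quot (derivative q.num * q.denom - q.num * derivative q.denom) (q.denom ^ 2)

/-- `A / B` solves the interpolation problem, with the conditions read as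
`(A / B)^(j) (x_i) / j ! = y_{i, j}`, the left-hand side being the `j`-th Taylor coefficient of
`A / B` at `x_i`. -/
def IsSolution {k : ℕ} (a b : ℕ) (x : Fin (k + 1) → K) (m : Fin (k + 1) → ℕ)
    (y : (i : Fin (k + 1)) → Fin (m i) → K) (A B : K[X]) : Prop :=
  A.degree ≤ a ∧ B.degree ≤ b ∧ B ≠ 0 ∧
    ∀ (i : Fin (k + 1)) (j : Fin (m i)),
      RegularAt (quot A B) (x i) ∧ taylorCoeff (quot A B) (x i) j = y i j

/-- `A / B` solves the interpolation problem, with the conditions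
`(A / B)^(j) (x_i) = j ! * y_{i, j}` on the iterated formal derivatives of `A / B`. -/
def IsDerivSolution {k : ℕ} (a b : ℕ) (x : Fin (k + 1) → K) (m : Fin (k + 1) → ℕ)
    (y : (i : Fin (k + 1)) → Fin (m i) → K) (A B : K[X]) : Prop :=
  A.degree ≤ a ∧ B.degree ≤ b ∧ B ≠ 0 ∧
    ∀ (i : Fin (k + 1)) (j : Fin (m i)),
      RegularAt (quot A B) (x i) ∧
        (ratDeriv^[j] (quot A B)).eval (RingHom.id K) (x i) =
          (Nat.factorial (j : ℕ) : K) * y i j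

end

end Osculatory

/-! Clearing denominators linearizes the problem: at each node, `A` must agree with the data series
times `B` to order `m i` (`IsWeakSolution`). Under the bounds `deg A ≤ d`, `deg B ≤ l - d`, the
coefficient vectors of such pairs form the left kernel of the stacked matrix
(`vecMul_stacked_eq_zero_iff`). The cofactors of the bordering column lie in this kernel, and they
are, up to sign, the coefficients of `A₀` and `B₀`. A nonzero coefficient of `A₀` makes the kernel
one-dimensional (`eq_C_mul_of_isWeakSolution`).

Two linearized solutions of small degree are proportional as fractions, since `A * B' - A' * B` is
divisible by the nodal polynomial of degree `l + 1` (`IsWeakSolution.cross_mul_eq`). With maximality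
of `d` this gives `deg B₀ ≤ b` (`natDegree_B₀_le_of_maximal`). If a solution exists, a zero of `B₀`
at a node would allow a linear factor to be cancelled from `(A₀, B₀)`, against one-dimensionality
(`IsSolution.eval_B₀_ne_zero`). Conversely, where `B₀` does not vanish, the linearization can be
undone. -/

namespace Osculatory

/-! ### The linearized interpolation problem -/

section Weak

variable {K : Type*} [Field K] {k : ℕ}

/-- The truncated power series at the node `x i` prescribed by the data `y i`. -/
noncomputable def dataSeries (m : Fin (k + 1) → ℕ) (y : (i : Fin (k + 1)) → Fin (m i) → K)
    (i : Fin (k + 1)) : PowerSeries K :=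
  PowerSeries.mk fun t => if h : t < m i then y i ⟨t, h⟩ else 0

/-- The linearized interpolation conditions: at every node `x i`, the Taylor expansion of `A`
agrees with the product of the data series and the Taylor expansion of `B` up to order `m i`. -/
def IsWeakSolution (x : Fin (k + 1) → K) (m : Fin (k + 1) → ℕ)
    (y : (i : Fin (k + 1)) → Fin (m i) → K) (A B : K[X]) : Prop :=
  ∀ i, (PowerSeries.X : PowerSeries K) ^ m i ∣
    (taylor (x i) A : PowerSeries K) - dataSeries m y i * (taylor (x i) B : PowerSeries K)

variable {x : Fin (k + 1) → K} {m : Fin (k + 1) → ℕ} {y : (i : Fin (k + 1)) → Fin (m i) → K}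

theorem IsWeakSolution.sub {A B A' B' : K[X]} (h : IsWeakSolution x m y A B)
    (h' : IsWeakSolution x m y A' B') : IsWeakSolution x m y (A - A') (B - B') := by
  intro i
  convert dvd_sub (h i) (h' i) using 1
  simp only [map_sub, Polynomial.coe_sub]
  ring

theorem IsWeakSolution.mul_left {A B : K[X]} (h : IsWeakSolution x m y A B) (p : K[X]) :
    IsWeakSolution x m y (p * A) (p * B) := by
  intro i
  convert (h i).mul_left (taylor (x i) p : PowerSeries K) using 1
  simp only [taylor_mul, Polynomial.coe_mul]
  ring

theorem coeff_dataSeries_mul (B : K[X]) (i : Fin (k + 1)) (t : Fin (m i)) :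
    PowerSeries.coeff t (dataSeries m y i * (taylor (x i) B : PowerSeries K)) =
      ∑ j : Fin ((t : ℕ) + 1), y i ⟨(t : ℕ) - (j : ℕ), by omega⟩ * (taylor (x i) B).coeff j := by
  rw [mul_comm, PowerSeries.coeff_mul, Finset.Nat.sum_antidiagonal_eq_sum_range_succ_mk,
    ← Fin.sum_univ_eq_sum_range (fun j => PowerSeries.coeff j (taylor (x i) B : PowerSeries K) *
      PowerSeries.coeff ((t : ℕ) - j) (dataSeries m y i))]
  refine Finset.sum_congr rfl fun j _ => ?_
  have h : (t : ℕ) - (j : ℕ) < m i := by omega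
  simp [dataSeries, h, mul_comm]

theorem isWeakSolution_iff {A B : K[X]} : IsWeakSolution x m y A B ↔
    ∀ (i : Fin (k + 1)) (t : Fin (m i)), (taylor (x i) A).coeff t =
      ∑ j : Fin ((t : ℕ) + 1), y i ⟨(t : ℕ) - (j : ℕ), by omega⟩ * (taylor (x i) B).coeff j := by
  refine forall_congr' fun i => ?_
  rw [PowerSeries.X_pow_dvd_iff]
  constructor
  · intro h t
    have := h t t.2
    rwa [map_sub, coeff_dataSeries_mul, Polynomial.coeff_coe, sub_eq_zero] at this
  · intro h t ht
    have := h ⟨t, ht⟩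
    rw [map_sub, sub_eq_zero, Polynomial.coeff_coe]
    exact this.trans (coeff_dataSeries_mul B i ⟨t, ht⟩).symm

theorem X_pow_dvd_of_coe {n : ℕ} {p : K[X]}
    (h : (PowerSeries.X : PowerSeries K) ^ n ∣ (p : PowerSeries K)) : X ^ n ∣ p := by
  rw [PowerSeries.X_pow_dvd_iff] at h
  rw [Polynomial.X_pow_dvd_iff]
  intro t ht
  simpa using h t ht

theorem X_sub_C_pow_dvd_of_taylor {n : ℕ} {c : K} {p : K[X]} (h : X ^ n ∣ taylor c p) :
    (X - C c) ^ n ∣ p := by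
  obtain ⟨q, hq⟩ := h
  refine ⟨taylor (-c) q, ?_⟩
  have := congrArg (taylor (-c)) hq
  rw [taylor_taylor, neg_add_cancel, taylor_zero, taylor_mul, taylor_X_pow] at this
  simpa [sub_eq_add_neg] using this

/-- With `Y` the data series at a node, `A * B'` and `A' * B` are both congruent to `Y * B * B'`.
Distinct nodes give coprime prime powers, so the local divisibilities multiply. -/
theorem IsWeakSolution.nodal_dvd (hx : Function.Injective x) {A B A' B' : K[X]}
    (h : IsWeakSolution x m y A B) (h' : IsWeakSolution x m y A' B') :
    ∏ i, (X - C (x i)) ^ m i ∣ A * B' - A' * B := by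
  refine Finset.prod_dvd_of_coprime ?_ ?_
  · intro i _ j _ hij
    exact (isCoprime_X_sub_C_of_isUnit_sub
      (sub_ne_zero.2 (hx.ne hij)).isUnit).pow
  · intro i _
    refine X_sub_C_pow_dvd_of_taylor (X_pow_dvd_of_coe ?_)
    convert dvd_sub ((h i).mul_right (taylor (x i) B' : PowerSeries K))
      ((h' i).mul_right (taylor (x i) B : PowerSeries K)) using 1
    simp only [map_sub, taylor_mul, Polynomial.coe_sub, Polynomial.coe_mul]
    ring

theorem IsWeakSolution.cross_mul_eq (hx : Function.Injective x) {A B A' B' : K[X]}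
    (h : IsWeakSolution x m y A B) (h' : IsWeakSolution x m y A' B')
    (hdeg : (A * B' - A' * B).degree < (∑ i, m i : ℕ)) : A * B' = A' * B := by
  refine sub_eq_zero.1 (eq_zero_of_dvd_of_degree_lt (h.nodal_dvd hx h') ?_)
  rw [degree_prod]
  simpa [degree_pow] using hdeg

end Weak

/-! ### Determinants, cofactors and the left kernel -/

section Cofactors

variable {K : Type*} [Field K] {k : ℕ}

/-- The bordered matrix over `K` with last column zero. -/
noncomputable def stacked (x : Fin (k + 1) → K) (m : Fin (k + 1) → ℕ)
    (y : (i : Fin (k + 1)) → Fin (m i) → K) (l : ℕ) (hm : ∑ i, m i = l + 1)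
    (d : ℕ) (hd : d ≤ l) : Matrix (Fin (l + 2)) (Fin (l + 2)) K :=
  Matrix.reindex (rowEquiv d l hd) (colEquiv m l hm)
    (Matrix.fromBlocks (confluentV x m (d + 1)) 0 (dataU x m y (l - d + 1)) 0)

/-- The index of the additional column. -/
def lastCol (m : Fin (k + 1) → ℕ) (l : ℕ) (hm : ∑ i, m i = l + 1) : Fin (l + 2) :=
  colEquiv m l hm (Sum.inr 0)

/-- Minus the polynomial whose coefficients are the entries of `u` in the upper block of rows. -/
noncomputable def upperPoly (l d : ℕ) (hd : d ≤ l) (u : Fin (l + 2) → K) : K[X] :=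
  -∑ r : Fin (d + 1), C (u (rowEquiv d l hd (Sum.inl r))) * X ^ (r : ℕ)

/-- The polynomial whose coefficients are the entries of `u` in the lower block of rows. -/
noncomputable def lowerPoly (l d : ℕ) (hd : d ≤ l) (u : Fin (l + 2) → K) : K[X] :=
  ∑ r : Fin (l - d + 1), C (u (rowEquiv d l hd (Sum.inr r))) * X ^ (r : ℕ)

/-- The cofactors of the additional column. -/
noncomputable def cofactors (x : Fin (k + 1) → K) (m : Fin (k + 1) → ℕ)
    (y : (i : Fin (k + 1)) → Fin (m i) → K) (l : ℕ) (hm : ∑ i, m i = l + 1)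
    (d : ℕ) (hd : d ≤ l) (r : Fin (l + 2)) : K :=
  (stacked x m y l hm d hd).adjugate (lastCol m l hm) r

theorem coeff_sum_C_mul_X_pow {n : ℕ} (w : Fin n → K) (t : ℕ) :
    (∑ r : Fin n, C (w r) * X ^ (r : ℕ)).coeff t = if h : t < n then w ⟨t, h⟩ else 0 := by
  rw [finsetSum_coeff]
  simp only [coeff_C_mul_X_pow]
  split_ifs with h
  · rw [Finset.sum_eq_single ⟨t, h⟩]
    · simp
    · intro b _ hb
      rw [if_neg]
      rintro rfl
      exact hb rfl
    · simp
  · refine Finset.sum_eq_zero fun r _ => if_neg ?_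
    have := r.2
    omega

theorem degree_sum_C_mul_X_pow_le {n : ℕ} (w : Fin (n + 1) → K) :
    (∑ r : Fin (n + 1), C (w r) * X ^ (r : ℕ) : K[X]).degree ≤ (n : WithBot ℕ) := by
  rw [degree_le_iff_coeff_zero]
  intro t ht
  rw [coeff_sum_C_mul_X_pow, dif_neg]
  have : n < t := by exact_mod_cast ht
  omega

theorem coeff_taylor_sum_C_mul_X_pow {n : ℕ} (w : Fin n → K) (c : K) (t : ℕ) :
    (taylor c (∑ r : Fin n, C (w r) * X ^ (r : ℕ))).coeff t =
      ∑ r : Fin n, w r * (((r : ℕ).choose t : K) * c ^ ((r : ℕ) - t)) := by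
  rw [map_sum, finsetSum_coeff]
  refine Finset.sum_congr rfl fun r _ => ?_
  rw [taylor_coeff, C_mul_X_pow_eq_monomial, hasseDeriv_monomial, eval_monomial]
  ring

variable (x : Fin (k + 1) → K) (m : Fin (k + 1) → ℕ) (y : (i : Fin (k + 1)) → Fin (m i) → K)
  (l : ℕ) (hm : ∑ i, m i = l + 1) (d : ℕ) (hd : d ≤ l)

theorem degree_upperPoly_le (u : Fin (l + 2) → K) : (upperPoly l d hd u).degree ≤ d := by
  rw [upperPoly, degree_neg]
  exact degree_sum_C_mul_X_pow_le _

theorem degree_lowerPoly_le (u : Fin (l + 2) → K) :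
    (lowerPoly l d hd u).degree ≤ (l - d : ℕ) :=
  degree_sum_C_mul_X_pow_le _

theorem coeff_upperPoly (u : Fin (l + 2) → K) (r : Fin (d + 1)) :
    (upperPoly l d hd u).coeff r = -u (rowEquiv d l hd (Sum.inl r)) := by
  rw [upperPoly, coeff_neg, coeff_sum_C_mul_X_pow, dif_pos r.2]

theorem eq_zero_of_polys_eq_zero {u : Fin (l + 2) → K} (h₁ : upperPoly l d hd u = 0)
    (h₂ : lowerPoly l d hd u = 0) : u = 0 := by
  funext s
  obtain ⟨s, rfl⟩ := (rowEquiv d l hd).surjective s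
  rcases s with r | r
  · have := coeff_upperPoly l d hd u r
    rw [h₁, coeff_zero] at this
    simpa using this.symm
  · have := coeff_sum_C_mul_X_pow (fun r => u (rowEquiv d l hd (Sum.inr r))) r
    change (lowerPoly l d hd u).coeff r = _ at this
    rw [h₂, coeff_zero, dif_pos r.2] at this
    exact this.symm

theorem exists_polys_eq {A B : K[X]} (hA : A.degree ≤ d) (hB : B.degree ≤ (l - d : ℕ)) :
    ∃ u : Fin (l + 2) → K, upperPoly l d hd u = A ∧ lowerPoly l d hd u = B := by
  refine ⟨fun s => Sum.elim (fun r : Fin (d + 1) => -A.coeff r)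
    (fun r : Fin (l - d + 1) => B.coeff r) ((rowEquiv d l hd).symm s), ?_, ?_⟩
  · ext t
    rw [upperPoly, coeff_neg, coeff_sum_C_mul_X_pow]
    split_ifs with h
    · simp
    · rw [coeff_eq_zero_of_degree_lt (lt_of_le_of_lt hA (by exact_mod_cast by omega)), neg_zero]
  · ext t
    rw [lowerPoly, coeff_sum_C_mul_X_pow]
    split_ifs with h
    · simp
    · rw [coeff_eq_zero_of_degree_lt (lt_of_le_of_lt hB (by exact_mod_cast by omega))]

/-- The entries `(r choose t) * x_i ^ (r - t)` are the Taylor coefficients of `X ^ r` at `x_i`, so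
each column encodes one linearized condition. The minus sign in `upperPoly` turns the sum of the two
blocks into a difference. -/
theorem vecMul_stacked (u : Fin (l + 2) → K) (i : Fin (k + 1)) (t : Fin (m i)) :
    Matrix.vecMul u (stacked x m y l hm d hd) (colEquiv m l hm (Sum.inl ⟨i, t⟩)) =
      ∑ j : Fin ((t : ℕ) + 1), y i ⟨(t : ℕ) - (j : ℕ), by omega⟩ *
        (taylor (x i) (lowerPoly l d hd u)).coeff j -
      (taylor (x i) (upperPoly l d hd u)).coeff t := by
  rw [Matrix.vecMul, dotProduct, ← (rowEquiv d l hd).sum_comp, Fintype.sum_sum_type, upperPoly,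
    lowerPoly, map_neg, coeff_neg, sub_neg_eq_add, add_comm]
  simp only [coeff_taylor_sum_C_mul_X_pow]
  congr 1
  · simp only [stacked, Matrix.reindex_apply, Matrix.submatrix_apply, Equiv.symm_apply_apply,
      Matrix.fromBlocks_apply₂₁, dataU, Finset.mul_sum]
    rw [Finset.sum_comm]
    refine Finset.sum_congr rfl fun j _ => Finset.sum_congr rfl fun r _ => ?_
    ring
  · simp [stacked, confluentV]

theorem vecMul_stacked_lastCol (u : Fin (l + 2) → K) :
    Matrix.vecMul u (stacked x m y l hm d hd) (lastCol m l hm) = 0 := by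
  rw [Matrix.vecMul, dotProduct]
  refine Finset.sum_eq_zero fun s _ => ?_
  obtain ⟨s, rfl⟩ := (rowEquiv d l hd).surjective s
  rcases s with r | r <;> simp [stacked, lastCol]

theorem vecMul_stacked_eq_zero_iff (u : Fin (l + 2) → K) :
    Matrix.vecMul u (stacked x m y l hm d hd) = 0 ↔
      IsWeakSolution x m y (upperPoly l d hd u) (lowerPoly l d hd u) := by
  rw [isWeakSolution_iff]
  constructor
  · intro h i t
    have := vecMul_stacked x m y l hm d hd u i t
    rw [h, Pi.zero_apply] at this
    exact (sub_eq_zero.1 this.symm).symm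
  · intro h
    funext c
    obtain ⟨c, rfl⟩ := (colEquiv m l hm).surjective c
    rcases c with ⟨i, t⟩ | c
    · rw [vecMul_stacked, ← h i t, sub_self, Pi.zero_apply]
    · rw [Subsingleton.elim c 0]
      exact vecMul_stacked_lastCol x m y l hm d hd u

/-- Off-diagonal entries of `adjugate * matrix` vanish, and the remaining entry belongs to the zero
column. -/
theorem vecMul_cofactors :
    Matrix.vecMul (cofactors x m y l hm d hd) (stacked x m y l hm d hd) = 0 := by
  funext c
  rcases eq_or_ne c (lastCol m l hm) with rfl | hc
  · exact vecMul_stacked_lastCol x m y l hm d hd _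
  · have := congrFun (congrFun (Matrix.adjugate_mul (stacked x m y l hm d hd))
      (lastCol m l hm)) c
    rw [Matrix.smul_apply, Matrix.one_apply_ne hc.symm, smul_zero] at this
    exact this

theorem bordered_eq_updateCol (top : Fin (d + 1) → K[X]) (bottom : Fin (l - d + 1) → K[X]) :
    bordered x m y l hm d hd top bottom =
      ((stacked x m y l hm d hd).map C).updateCol (lastCol m l hm)
        (fun s => Sum.elim top bottom ((rowEquiv d l hd).symm s)) := by
  ext1 s c
  obtain ⟨s, rfl⟩ := (rowEquiv d l hd).surjective s
  obtain ⟨c, rfl⟩ := (colEquiv m l hm).surjective c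
  rcases c with c | c
  · have hne : colEquiv m l hm (Sum.inl c) ≠ lastCol m l hm := by simp [lastCol]
    rw [Matrix.updateCol_ne hne]
    rcases s with r | r <;> rw [bordered, Matrix.reindex_apply, Matrix.submatrix_apply,
      Equiv.symm_apply_apply, Equiv.symm_apply_apply] <;> simp [stacked] <;> rfl
  · rw [Subsingleton.elim c 0]
    change _ = Matrix.updateCol _ (lastCol m l hm) _ _ (lastCol m l hm)
    rw [Matrix.updateCol_self]
    rcases s with r | r <;> rw [bordered, Matrix.reindex_apply, Matrix.submatrix_apply,
      Equiv.symm_apply_apply, Equiv.symm_apply_apply] <;> simp <;> rfl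

/-- Laplace expansion along the last column. The cofactors do not depend on that column, so `A₀` and
`B₀` share one vector of cofactors. -/
theorem det_bordered (top : Fin (d + 1) → K[X]) (bottom : Fin (l - d + 1) → K[X]) :
    (bordered x m y l hm d hd top bottom).det =
      ∑ r, C (cofactors x m y l hm d hd (rowEquiv d l hd (Sum.inl r))) * top r +
      ∑ r, C (cofactors x m y l hm d hd (rowEquiv d l hd (Sum.inr r))) * bottom r := by
  rw [bordered_eq_updateCol, ← Matrix.cramer_apply, Matrix.cramer_eq_adjugate_mulVec,
    ← RingHom.mapMatrix_apply, ← RingHom.map_adjugate, Matrix.mulVec, dotProduct,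
    ← (rowEquiv d l hd).sum_comp, Fintype.sum_sum_type]
  simp [cofactors]

theorem A₀_eq_upperPoly :
    A₀ x m y l hm d hd = upperPoly l d hd (cofactors x m y l hm d hd) := by
  simp [A₀, det_bordered, upperPoly]

theorem B₀_eq_lowerPoly :
    B₀ x m y l hm d hd = lowerPoly l d hd (cofactors x m y l hm d hd) := by
  simp [B₀, det_bordered, lowerPoly]

theorem degree_A₀_le : (A₀ x m y l hm d hd).degree ≤ d := by
  rw [A₀_eq_upperPoly]
  exact degree_upperPoly_le l d hd _

theorem degree_B₀_le : (B₀ x m y l hm d hd).degree ≤ (l - d : ℕ) := by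
  rw [B₀_eq_lowerPoly]
  exact degree_lowerPoly_le l d hd _

theorem isWeakSolution_A₀_B₀ :
    IsWeakSolution x m y (A₀ x m y l hm d hd) (B₀ x m y l hm d hd) := by
  rw [A₀_eq_upperPoly, B₀_eq_lowerPoly, ← vecMul_stacked_eq_zero_iff x m y l hm]
  exact vecMul_cofactors x m y l hm d hd

/-- The `r`-th coefficient of `A₀` vanishes if and only if the linearized problem has a nontrivial
solution `(A, B)` in which the `r`-th coefficient of `A` vanishes. -/
theorem coeff_A₀_eq_zero_iff {r : ℕ} (hr : r ≤ d) :
    (A₀ x m y l hm d hd).coeff r = 0 ↔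
      ∃ A B : K[X], A.degree ≤ d ∧ B.degree ≤ (l - d : ℕ) ∧ IsWeakSolution x m y A B ∧
        A.coeff r = 0 ∧ ¬(A = 0 ∧ B = 0) := by
  set s : Fin (l + 2) := rowEquiv d l hd (Sum.inl ⟨r, by omega⟩) with hs
  -- The determinant of `M` is the cofactor at `s`, and the new column adds the equation `u s = 0`
  -- to the left kernel.
  set M := (stacked x m y l hm d hd).updateCol (lastCol m l hm) (Pi.single s 1) with hM
  have hcoeff (u : Fin (l + 2) → K) : (upperPoly l d hd u).coeff r = -u s :=
    coeff_upperPoly l d hd u ⟨r, by omega⟩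
  have hdet : (A₀ x m y l hm d hd).coeff r = -M.det := by
    rw [A₀_eq_upperPoly, hcoeff, hM, ← Matrix.cramer_apply, Matrix.cramer_eq_adjugate_mulVec]
    simp [cofactors]
  have hker (u : Fin (l + 2) → K) : Matrix.vecMul u M = 0 ↔
      Matrix.vecMul u (stacked x m y l hm d hd) = 0 ∧ u s = 0 := by
    have hlast : Matrix.vecMul u M (lastCol m l hm) = u s := by
      simp [Matrix.vecMul, dotProduct, hM, Pi.single_apply]
    have hne (c) (hc : c ≠ lastCol m l hm) :
        Matrix.vecMul u M c = Matrix.vecMul u (stacked x m y l hm d hd) c := by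
      simp [Matrix.vecMul, dotProduct, hM, Matrix.updateCol_ne hc]
    constructor
    · intro h
      refine ⟨?_, by rw [← hlast, h]; rfl⟩
      funext c
      rcases eq_or_ne c (lastCol m l hm) with rfl | hc
      · exact vecMul_stacked_lastCol x m y l hm d hd u
      · rw [← hne c hc, h]
    · rintro ⟨h, h'⟩
      funext c
      rcases eq_or_ne c (lastCol m l hm) with rfl | hc
      · rw [hlast, h']; rfl
      · rw [hne c hc, h]
  rw [hdet, neg_eq_zero, ← Matrix.exists_vecMul_eq_zero_iff]
  constructor
  · rintro ⟨u, hu, h⟩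
    obtain ⟨h₁, h₂⟩ := (hker u).1 h
    refine ⟨_, _, degree_upperPoly_le l d hd u, degree_lowerPoly_le l d hd u,
      (vecMul_stacked_eq_zero_iff x m y l hm d hd u).1 h₁, by rw [hcoeff, h₂, neg_zero], ?_⟩
    exact fun h => hu (eq_zero_of_polys_eq_zero l d hd h.1 h.2)
  · rintro ⟨A, B, hA, hB, hw, hr0, h0⟩
    obtain ⟨u, rfl, rfl⟩ := exists_polys_eq l d hd hA hB
    refine ⟨u, ?_, (hker u).2 ⟨(vecMul_stacked_eq_zero_iff x m y l hm d hd u).2 hw, ?_⟩⟩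
    · rintro rfl
      exact h0 ⟨by simp [upperPoly], by simp [lowerPoly]⟩
    · rwa [hcoeff, neg_eq_zero] at hr0

/-- If `A₀ ≠ 0`, then the linearized problem has only the multiples of `(A₀, B₀)` as solutions. -/
theorem eq_C_mul_of_isWeakSolution (hne : A₀ x m y l hm d hd ≠ 0) {A B : K[X]}
    (hA : A.degree ≤ d) (hB : B.degree ≤ (l - d : ℕ)) (h : IsWeakSolution x m y A B) :
    ∃ c : K, A = C c * A₀ x m y l hm d hd ∧ B = C c * B₀ x m y l hm d hd := by
  have hr : (A₀ x m y l hm d hd).natDegree ≤ d :=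
    natDegree_le_of_degree_le (degree_A₀_le x m y l hm d hd)
  have hlead : (A₀ x m y l hm d hd).coeff (A₀ x m y l hm d hd).natDegree ≠ 0 := by simpa using hne
  set r := (A₀ x m y l hm d hd).natDegree
  have hno := mt (coeff_A₀_eq_zero_iff x m y l hm d hd hr).2 hlead
  -- This scalar makes the `r`-th coefficient of `A - c * A₀` vanish, so the difference of the pairs
  -- must be zero by `hno`.
  refine ⟨A.coeff r / (A₀ x m y l hm d hd).coeff r, ?_⟩
  set c := A.coeff r / (A₀ x m y l hm d hd).coeff r with hc
  by_contra hcon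
  refine hno ⟨A - C c * A₀ x m y l hm d hd, B - C c * B₀ x m y l hm d hd, ?_, ?_,
    h.sub ((isWeakSolution_A₀_B₀ x m y l hm d hd).mul_left (C c)), ?_, ?_⟩
  · exact (degree_sub_le _ _).trans (max_le hA
      ((C_mul' c _ ▸ degree_smul_le c _).trans (degree_A₀_le x m y l hm d hd)))
  · exact (degree_sub_le _ _).trans (max_le hB
      ((C_mul' c _ ▸ degree_smul_le c _).trans (degree_B₀_le x m y l hm d hd)))
  · rw [coeff_sub, coeff_C_mul, hc, div_mul_cancel₀ _ hlead, sub_self]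
  · rwa [sub_eq_zero, sub_eq_zero]

end Cofactors

/-! ### Taylor expansions and derivatives of rational functions -/

section Regular

variable {K : Type*} [Field K]

theorem quot_eq_quot_iff {A B A' B' : K[X]} (hB : B ≠ 0) (hB' : B' ≠ 0) :
    quot A B = quot A' B' ↔ A * B' = A' * B := by
  have h : algebraMap K[X] (RatFunc K) B ≠ 0 := by simpa using hB
  have h' : algebraMap K[X] (RatFunc K) B' ≠ 0 := by simpa using hB'
  rw [quot, quot, div_eq_div_iff h h', ← map_mul, ← map_mul]
  exact (IsFractionRing.injective K[X] (RatFunc K)).eq_iff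

theorem exists_eq_mul_num_denom (A : K[X]) {B : K[X]} (hB : B ≠ 0) :
    ∃ s, A = s * (quot A B).num ∧ B = s * (quot A B).denom := by
  obtain ⟨s, hs⟩ := RatFunc.denom_div_dvd A B
  change B = (quot A B).denom * s at hs
  refine ⟨s, ?_, hs.trans (mul_comm _ _)⟩
  have h := (quot_eq_quot_iff hB (RatFunc.denom_ne_zero _)).1
    (RatFunc.num_div_denom (quot A B)).symm
  refine mul_right_cancel₀ (RatFunc.denom_ne_zero (quot A B)) 
    (h.trans ((congrArg ((quot A B).num * ·) hs).trans ?_))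
  ring

/-- The Taylor expansion at `c` of a rational function that is regular at `c`. -/
noncomputable def taylorSeries (q : RatFunc K) (c : K) : PowerSeries K :=
  (taylor c q.num : PowerSeries K) * (taylor c q.denom : PowerSeries K)⁻¹

theorem constantCoeff_taylor (c : K) (p : K[X]) :
    PowerSeries.constantCoeff (taylor c p : PowerSeries K) = p.eval c := by
  rw [← PowerSeries.coeff_zero_eq_constantCoeff_apply, Polynomial.coeff_coe, taylor_coeff_zero]

theorem constantCoeff_taylor_ne_zero {q : RatFunc K} {c : K} (h : RegularAt q c) :
    PowerSeries.constantCoeff (taylor c q.denom : PowerSeries K) ≠ 0 := by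
  rwa [constantCoeff_taylor]

theorem taylorSeries_mul_denom {q : RatFunc K} {c : K} (h : RegularAt q c) :
    taylorSeries q c * (taylor c q.denom : PowerSeries K) = (taylor c q.num : PowerSeries K) := by
  rw [taylorSeries, mul_assoc, PowerSeries.inv_mul_cancel _ (constantCoeff_taylor_ne_zero h),
    mul_one]

theorem regularAt_quot {A B : K[X]} {c : K} (h : B.eval c ≠ 0) : RegularAt (quot A B) c := by
  have hB : B ≠ 0 := by rintro rfl; simp at h
  obtain ⟨s, -, hs⟩ := exists_eq_mul_num_denom A hB
  rw [hs, eval_mul] at h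
  exact right_ne_zero_of_mul h

theorem taylorSeries_quot_mul {A B : K[X]} {c : K} (hB : B ≠ 0) (h : RegularAt (quot A B) c) :
    taylorSeries (quot A B) c * (taylor c B : PowerSeries K) = (taylor c A : PowerSeries K) := by
  obtain ⟨s, hsA, hsB⟩ := exists_eq_mul_num_denom A hB
  have h₁ : (taylor c B : PowerSeries K) =
      (taylor c s : PowerSeries K) * (taylor c (quot A B).denom : PowerSeries K) := by
    rw [← Polynomial.coe_mul, ← taylor_mul, ← hsB]
  have h₂ : (taylor c A : PowerSeries K) =
      (taylor c s : PowerSeries K) * (taylor c (quot A B).num : PowerSeries K) := by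
    rw [← Polynomial.coe_mul, ← taylor_mul, ← hsA]
  rw [h₁, h₂, ← taylorSeries_mul_denom h]
  ring

theorem taylor_derivative (c : K) (p : K[X]) :
    taylor c (derivative p) = derivative (taylor c p) := by
  simp [taylor_apply, derivative_comp]

theorem regularAt_ratDeriv {q : RatFunc K} {c : K} (h : RegularAt q c) :
    RegularAt (ratDeriv q) c :=
  regularAt_quot (by rw [eval_pow]; exact pow_ne_zero 2 h)

/-- With `S`, `N`, `D` the expansions of `q`, its numerator and its denominator, differentiating `S
* D = N` gives `S' * D ^ 2 = N' * D - N * D'`; then `D ^ 2` is cancelled. -/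
theorem taylorSeries_ratDeriv {q : RatFunc K} {c : K} (h : RegularAt q c) :
    taylorSeries (ratDeriv q) c = PowerSeries.derivative K (taylorSeries q c) := by
  have hD0 := constantCoeff_taylor_ne_zero h
  have hD : (taylor c q.denom : PowerSeries K) ≠ 0 := by
    intro h0; rw [h0] at hD0; simp at hD0
  have h₁ := taylorSeries_quot_mul (pow_ne_zero 2 (RatFunc.denom_ne_zero q))
    (regularAt_ratDeriv h)
  change taylorSeries (ratDeriv q) c * _ = _ at h₁
  have h₂ := taylorSeries_mul_denom h
  have h₃ := congrArg (PowerSeries.derivative K) h₂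
  rw [Derivation.leibniz, PowerSeries.derivative_coe, PowerSeries.derivative_coe,
    ← taylor_derivative, ← taylor_derivative, smul_eq_mul, smul_eq_mul] at h₃
  simp only [map_sub, taylor_mul, taylor_pow, Polynomial.coe_sub, Polynomial.coe_mul,
    Polynomial.coe_pow] at h₁
  refine mul_right_cancel₀ (pow_ne_zero 2 hD) (h₁.trans ?_)
  rw [← h₂, ← h₃]
  ring

theorem regularAt_iterate_ratDeriv {q : RatFunc K} {c : K} (h : RegularAt q c) (j : ℕ) :
    RegularAt (ratDeriv^[j] q) c ∧
      taylorSeries (ratDeriv^[j] q) c = (PowerSeries.derivative K)^[j] (taylorSeries q c) := by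
  induction j with
  | zero => exact ⟨h, rfl⟩
  | succ j ih =>
    rw [Function.iterate_succ_apply', Function.iterate_succ_apply', ← ih.2]
    exact ⟨regularAt_ratDeriv ih.1, taylorSeries_ratDeriv ih.1⟩

theorem eval_eq_constantCoeff_taylorSeries (q : RatFunc K) (c : K) :
    q.eval (RingHom.id K) c = PowerSeries.constantCoeff (taylorSeries q c) := by
  rw [taylorSeries, map_mul, PowerSeries.constantCoeff_inv, constantCoeff_taylor,
    constantCoeff_taylor, RatFunc.eval, eval₂_id, eval₂_id, div_eq_mul_inv]

/-- The iterated formal derivatives of a regular rational function are its Taylor coefficients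
up to factorials. -/
theorem eval_iterate_ratDeriv {q : RatFunc K} {c : K} (h : RegularAt q c) (j : ℕ) :
    (ratDeriv^[j] q).eval (RingHom.id K) c = (Nat.factorial j : K) * taylorCoeff q c j := by
  rw [eval_eq_constantCoeff_taylorSeries, (regularAt_iterate_ratDeriv h j).2,
    PowerSeries.constantCoeff_iterate_derivative]
  simp [taylorCoeff, taylorSeries]

theorem isDerivSolution_iff {k : ℕ} {a b : ℕ} {x : Fin (k + 1) → K} {m : Fin (k + 1) → ℕ}
    {y : (i : Fin (k + 1)) → Fin (m i) → K}
    (hfac : ∀ i, ∀ j < m i, (Nat.factorial j : K) ≠ 0) {A B : K[X]} :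
    IsDerivSolution a b x m y A B ↔ IsSolution a b x m y A B := by
  refine and_congr_right fun _ => and_congr_right fun _ => and_congr_right fun _ =>
    forall_congr' fun i => forall_congr' fun j => and_congr_right fun h => ?_
  rw [eval_iterate_ratDeriv h]
  exact mul_right_inj' (hfac i j j.2)

end Regular

/-! ### Degree bound, solvability and uniqueness -/

section Main

variable {K : Type*} [Field K] {k : ℕ} {x : Fin (k + 1) → K} {m : Fin (k + 1) → ℕ}
  {y : (i : Fin (k + 1)) → Fin (m i) → K}

theorem IsSolution.isWeakSolution {a b : ℕ} {A B : K[X]} (h : IsSolution a b x m y A B) :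
    IsWeakSolution x m y A B := by
  obtain ⟨-, -, hB, h⟩ := h
  intro i
  -- Regularity is available only at nodes with `0 < m i`; the others impose no condition.
  rcases Nat.eq_zero_or_pos (m i) with h0 | h0
  · rw [h0, pow_zero]
    exact one_dvd _
  · rw [← taylorSeries_quot_mul hB (h i ⟨0, h0⟩).1, ← sub_mul]
    refine Dvd.dvd.mul_right (PowerSeries.X_pow_dvd_iff.2 fun t ht => ?_) _
    rw [map_sub, sub_eq_zero]
    refine (h i ⟨t, ht⟩).2.trans ?_
    simp [dataSeries, ht]

/-- Where `B` does not vanish, its Taylor expansion is a unit and can be cancelled from the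
linearized condition. -/
theorem IsWeakSolution.isSolution {a b : ℕ} {A B : K[X]} (h : IsWeakSolution x m y A B)
    (hA : A.degree ≤ a) (hB : B.degree ≤ b) (hB0 : B ≠ 0)
    (hne : ∀ i, 0 < m i → B.eval (x i) ≠ 0) : IsSolution a b x m y A B := by
  refine ⟨hA, hB, hB0, fun i j => ?_⟩
  have hev := hne i (by have := j.2; omega)
  have hreg : RegularAt (quot A B) (x i) := regularAt_quot hev
  refine ⟨hreg, ?_⟩
  have hi := h i
  rw [← taylorSeries_quot_mul hB0 hreg, ← sub_mul] at hi
  have hunit : IsUnit (taylor (x i) B : PowerSeries K) := by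
    rw [PowerSeries.isUnit_iff_constantCoeff, constantCoeff_taylor]
    exact hev.isUnit
  have := PowerSeries.X_pow_dvd_iff.1 (hunit.dvd_mul_right.1 hi) j j.2
  rw [map_sub, sub_eq_zero] at this
  refine this.trans ?_
  simp [dataSeries]

/-- A solution remains one after cancelling common factors. -/
theorem IsSolution.num_denom {a b : ℕ} {A B : K[X]} (h : IsSolution a b x m y A B) :
    IsSolution a b x m y (quot A B).num (quot A B).denom := by
  obtain ⟨hA, hB, hB0, h⟩ := h
  obtain ⟨s, hsA, hsB⟩ := exists_eq_mul_num_denom A hB0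
  have hs : s ≠ 0 := by
    rintro rfl
    exact hB0 (by rw [hsB, zero_mul])
  have hq : quot (quot A B).num (quot A B).denom = quot A B := RatFunc.num_div_denom _
  refine ⟨?_, ?_, RatFunc.denom_ne_zero _, by rwa [hq]⟩
  · refine le_trans ?_ hA
    conv_rhs => rw [hsA, mul_comm]
    exact degree_le_mul_left _ hs
  · refine le_trans ?_ hB
    conv_rhs => rw [hsB, mul_comm]
    exact degree_le_mul_left _ hs

theorem natDegree_B₀_le_of_maximal (hx : Function.Injective x) (l : ℕ) (hm : ∑ i, m i = l + 1)
    (a : ℕ) (ha : a ≤ l) (d : ℕ) (hd : d ≤ a)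
    (hne : A₀ x m y l hm d (hd.trans ha) ≠ 0)
    (hmax : ∀ (d' : ℕ) (hd' : d' ≤ a), d < d' → A₀ x m y l hm d' (hd'.trans ha) = 0) :
    (B₀ x m y l hm d (hd.trans ha)).natDegree ≤ l - a := by
  by_contra! hcon
  have hA₀ := natDegree_le_of_degree_le (degree_A₀_le x m y l hm d (hd.trans ha))
  have hB₀ := natDegree_le_of_degree_le (degree_B₀_le x m y l hm d (hd.trans ha))
  have hw := isWeakSolution_A₀_B₀ x m y l hm d (hd.trans ha)
  have huniq := fun A B => eq_C_mul_of_isWeakSolution x m y l hm d (hd.trans ha) hne (A := A)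
    (B := B)
  set A₁ := A₀ x m y l hm d (hd.trans ha)
  set B₁ := B₀ x m y l hm d (hd.trans ha)
  have hB₁ : B₁ ≠ 0 := by
    intro h
    rw [h, natDegree_zero] at hcon
    omega
  -- Here `d ≤ e < a`, so maximality applies at `e + 1`. Vanishing of the top coefficient there
  -- yields a nontrivial pair with `deg A ≤ e` and `deg B < deg B₁`.
  obtain ⟨e, he⟩ : ∃ e, e + B₁.natDegree = l := ⟨l - B₁.natDegree, by omega⟩
  have hea : e + 1 ≤ a := by omega
  have hcoeff : (A₀ x m y l hm (e + 1) (hea.trans ha)).coeff (e + 1) = 0 := by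
    rw [hmax (e + 1) hea (by omega), coeff_zero]
  obtain ⟨A, B, hA, hB, hAB, hA0, h0⟩ :=
    (coeff_A₀_eq_zero_iff x m y l hm (e + 1) (hea.trans ha) le_rfl).1 hcoeff
  have hA' : A.natDegree ≤ e := by
    rw [natDegree_le_iff_coeff_eq_zero]
    intro t ht
    rcases (Nat.succ_le_of_lt ht).eq_or_lt with rfl | ht
    · exact hA0
    · exact coeff_eq_zero_of_natDegree_lt ((natDegree_le_of_degree_le hA).trans_lt ht)
  have hB' := natDegree_le_of_degree_le hB
  have hcross : A * B₁ = A₁ * B := by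
    refine hAB.cross_mul_eq hx hw (degree_le_natDegree.trans_lt ?_)
    rw [hm, Nat.cast_lt]
    refine Nat.lt_succ_of_le ((natDegree_sub_le _ _).trans (max_le ?_ ?_))
    · exact natDegree_mul_le.trans (by omega)
    · exact natDegree_mul_le.trans (by omega)
  have hAne : A ≠ 0 := by
    rintro rfl
    rw [zero_mul, eq_comm, mul_eq_zero] at hcross
    exact h0 ⟨rfl, hcross.resolve_left hne⟩
  have hBne : B ≠ 0 := by
    rintro rfl
    rw [mul_zero, mul_eq_zero] at hcross
    exact hAne (hcross.resolve_right hB₁)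
  have hdeg := congrArg natDegree hcross
  rw [natDegree_mul hAne hB₁, natDegree_mul hne hBne] at hdeg
  -- Comparing degrees in `hcross`, `deg B < deg B₁` forces `deg A < deg A₁ ≤ d`. The pair thus
  -- obeys the bounds for `d`, and `B` is a nonzero multiple of `B₁`, which its degree forbids.
  obtain ⟨c, -, hc⟩ := huniq A B (degree_le_of_natDegree_le (by omega))
    (degree_le_of_natDegree_le (by omega)) hAB
  have hc0 : c ≠ 0 := by
    rintro rfl
    exact hBne (by rw [hc, C_0, zero_mul])
  rw [hc, natDegree_C_mul hc0] at hB'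
  omega

theorem IsSolution.cross_mul_eq (hx : Function.Injective x) {a b : ℕ}
    (hm : ∑ i, m i = a + b + 1) {A B A' B' : K[X]} (h : IsSolution a b x m y A B)
    (h' : IsWeakSolution x m y A' B') (hA' : A'.degree ≤ a) (hB' : B'.degree ≤ b) :
    A * B' = A' * B := by
  refine h.isWeakSolution.cross_mul_eq hx h' (degree_le_natDegree.trans_lt ?_)
  rw [hm, Nat.cast_lt]
  have h₁ := natDegree_le_of_degree_le h.1
  have h₂ := natDegree_le_of_degree_le h.2.1
  have h₃ := natDegree_le_of_degree_le hA'
  have h₄ := natDegree_le_of_degree_le hB'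
  refine Nat.lt_succ_of_le ((natDegree_sub_le _ _).trans (max_le ?_ ?_))
  · exact natDegree_mul_le.trans (by omega)
  · exact natDegree_mul_le.trans (by omega)

/-- If a solution exists, then `B₀` does not vanish at the nodes. -/
theorem IsSolution.eval_B₀_ne_zero (hx : Function.Injective x) {a b : ℕ}
    (hm : ∑ i, m i = a + b + 1) {d : ℕ} (hd : d ≤ a) (hdl : d ≤ a + b)
    (hne : A₀ x m y (a + b) hm d hdl ≠ 0) (hB : (B₀ x m y (a + b) hm d hdl).degree ≤ b)
    {A B : K[X]} (h : IsSolution a b x m y A B) (i : Fin (k + 1)) (hi : 0 < m i) :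
    (B₀ x m y (a + b) hm d hdl).eval (x i) ≠ 0 := by
  have hA₀ := degree_A₀_le x m y (a + b) hm d hdl
  have hB₀ := degree_B₀_le x m y (a + b) hm d hdl
  have hw := isWeakSolution_A₀_B₀ x m y (a + b) hm d hdl
  have huniq := fun A B => eq_C_mul_of_isWeakSolution x m y (a + b) hm d hdl hne (A := A)
    (B := B)
  set A₁ := A₀ x m y (a + b) hm d hdl
  set B₁ := B₀ x m y (a + b) hm d hdl
  have hA₁a : A₁.degree ≤ a := hA₀.trans (by exact_mod_cast hd)
  have hnd := h.num_denom
  set P := (quot A B).num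
  set Q := (quot A B).denom
  have hcop : IsCoprime P Q := RatFunc.isCoprime_num_denom _
  have hcross : P * B₁ = A₁ * Q := hnd.cross_mul_eq hx hm hw hA₁a hB
  have hQ0 : Q ≠ 0 := RatFunc.denom_ne_zero _
  -- The reduced pair `(P, Q)` divides out: `(A₁, B₁) = (f * P, f * Q)`, so at the node only `f`
  -- could vanish.
  obtain ⟨f, hf⟩ : P ∣ A₁ := hcop.dvd_of_dvd_mul_right ⟨B₁, hcross.symm⟩
  have hP0 : P ≠ 0 := by
    intro h0
    exact hne (by rw [hf, h0, zero_mul])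
  have hf' : B₁ = Q * f := by
    refine mul_left_cancel₀ hP0 (hcross.trans ?_)
    rw [hf]
    ring
  have hQi : Q.eval (x i) ≠ 0 := (h.2.2.2 i ⟨0, hi⟩).1
  rw [hf', eval_mul]
  refine mul_ne_zero hQi fun hfi => ?_
  obtain ⟨g, hg⟩ := dvd_iff_isRoot.2 hfi
  have hA₁g : A₁ = (X - C (x i)) * (g * P) := by rw [hf, hg]; ring
  have hB₁g : B₁ = (X - C (x i)) * (g * Q) := by rw [hf', hg]; ring
  have hX : X - C (x i) ≠ 0 := X_sub_C_ne_zero _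
  have hg0 : g * P ≠ 0 := by
    intro h0
    exact hne (by rw [hA₁g, h0, mul_zero])
  have hle (p : K[X]) : p.degree ≤ ((X - C (x i)) * p).degree := by
    rw [mul_comm]
    exact degree_le_mul_left _ hX
  -- Cancelling `X - C (x i)` leaves a linearized solution because `(P, Q)` is one. It would be a
  -- scalar multiple of `(A₁, B₁)`, although `g * P` has degree one less than `A₁`.
  obtain ⟨c, hc, -⟩ := huniq (g * P) (g * Q) ((hle _).trans (hA₁g ▸ hA₀))
    ((hle _).trans (hB₁g ▸ hB₀)) (hnd.isWeakSolution.mul_left g)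
  have hc0 : c ≠ 0 := by
    rintro rfl
    exact hg0 (by rw [hc, C_0, zero_mul])
  have h₁ := congrArg natDegree hc
  have h₂ := congrArg natDegree hA₁g
  rw [natDegree_C_mul hc0] at h₁
  rw [natDegree_mul hX hg0, natDegree_X_sub_C] at h₂
  omega

end Main

end Osculatory

open Osculatory in
theorem theorem4p2 {K : Type*} [Field K] (a b k : ℕ)
    (x : Fin (k + 1) → K) (hx : Function.Injective x)
    (m : Fin (k + 1) → ℕ) (hm : ∑ i, m i = a + b + 1)
    (y : (i : Fin (k + 1)) → Fin (m i) → K)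
    (d : ℕ) (hd : d ≤ a)
    (hA : A₀ x m y (a + b) hm d (hd.trans (Nat.le_add_right a b)) ≠ 0)
    (hmax : ∀ (d' : ℕ) (hd' : d' ≤ a), d < d' →
      A₀ x m y (a + b) hm d' (hd'.trans (Nat.le_add_right a b)) = 0)
    (A0 B0 : Polynomial K)
    (hA0 : A0 = A₀ x m y (a + b) hm d (hd.trans (Nat.le_add_right a b)))
    (hB0 : B0 = B₀ x m y (a + b) hm d (hd.trans (Nat.le_add_right a b))) :
    B0.degree ≤ b ∧
    -- the problem in terms of Taylor coefficients, over every field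
    (((∃ A B, IsSolution a b x m y A B) ↔ ∀ i, 0 < m i → B0.eval (x i) ≠ 0) ∧
      ((∀ i, 0 < m i → B0.eval (x i) ≠ 0) →
        IsSolution a b x m y A0 B0 ∧
        ∀ A B, IsSolution a b x m y A B → quot A B = quot A0 B0)) ∧
    -- the problem in terms of iterated derivatives, if the factorials involved are invertible
    ((∀ i, ∀ j < m i, (Nat.factorial j : K) ≠ 0) →
      ((∃ A B, IsDerivSolution a b x m y A B) ↔ ∀ i, 0 < m i → B0.eval (x i) ≠ 0) ∧
      ((∀ i, 0 < m i → B0.eval (x i) ≠ 0) →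
        IsDerivSolution a b x m y A0 B0 ∧
        ∀ A B, IsDerivSolution a b x m y A B → quot A B = quot A0 B0)) := by
  have hdl := hd.trans (Nat.le_add_right a b)
  have hdegB : B0.degree ≤ b := by
    have := natDegree_B₀_le_of_maximal hx (a + b) hm a (Nat.le_add_right a b) d hd hA hmax
    rw [← hB0, Nat.add_sub_cancel_left] at this
    exact degree_le_of_natDegree_le this
  have hdegA : A0.degree ≤ a := by
    rw [hA0]
    exact (degree_A₀_le x m y (a + b) hm d hdl).trans (by exact_mod_cast hd)
  have hw : IsWeakSolution x m y A0 B0 := by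
    rw [hA0, hB0]
    exact isWeakSolution_A₀_B₀ x m y (a + b) hm d hdl
  have hexists : (∃ A B, IsSolution a b x m y A B) → ∀ i, 0 < m i → B0.eval (x i) ≠ 0 := by
    rintro ⟨A, B, h⟩ i hi
    rw [hB0] at hdegB ⊢
    exact h.eval_B₀_ne_zero hx hm hd hdl hA hdegB i hi
  have hsol (hne : ∀ i, 0 < m i → B0.eval (x i) ≠ 0) : IsSolution a b x m y A0 B0 := by
    refine hw.isSolution hdegA hdegB ?_ hne
    rintro rfl
    -- A zero `B0` is compatible with `hne` only if every `m i` is zero, but the `m i` sum to `a + b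
    -- + 1`.
    have hzero : ∀ i, m i = 0 := fun i => by
      by_contra h
      exact hne i (Nat.pos_of_ne_zero h) (by simp)
    simp [hzero] at hm
  have main : ((∃ A B, IsSolution a b x m y A B) ↔ ∀ i, 0 < m i → B0.eval (x i) ≠ 0) ∧
      ((∀ i, 0 < m i → B0.eval (x i) ≠ 0) →
        IsSolution a b x m y A0 B0 ∧
        ∀ A B, IsSolution a b x m y A B → quot A B = quot A0 B0) :=
    ⟨⟨hexists, fun hne => ⟨A0, B0, hsol hne⟩⟩, fun hne => ⟨hsol hne, fun A B h =>
      (quot_eq_quot_iff h.2.2.1 (hsol hne).2.2.1).2 (h.cross_mul_eq hx hm hw hdegA hdegB)⟩⟩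
  refine ⟨hdegB, main, fun hfac => ?_⟩
  simpa only [isDerivSolution_iff hfac] using main
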